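/- Let $G$ be a finite connected graph (multiple edges and loops allowed) with $n$ vertices, $m$ unoriented edges, vertex set $V(G)$ and arc set $D(G)$. Each unoriented edge, a loop included, gives two distinct mutually inverse arcs $e, e^{-1}$, so $|D(G)|=2m$; write $o(e)$ and $t(e)$ for the origin and terminus of an arc. Let $d_u\in\mathbb R$ $(u\in V(G))$, and for each arc $f$ let $h_f=h_{f^{-1}}\ge 0$ and $\gamma_f=-\gamma_{f^{-1}}\in[-\pi/2,\pi/2]$. Let $\mathbf H=(H_{uv})_{u,v\in V(G)}$ be the Hermitian matrix $$H_{uv}=\delta_{uv}d_u+\sum_{f:\,o(f)=u,\ t(f)=v}h_f e^{2i\gamma_f},\qquad \mathbf d=\mathrm{diag}(d_u)_{u\in V(G)},$$ so that $d_u=H_{uu}$ at every vertex without loops, and $\mathbf d=\mathrm{diag}(\mathbf H)$ if $G$ has no loops. Put $\Gamma_u=\sum_{o(f)=u}h_f$, and let $\lambda\in\mathbb C$ satisfy $d_u-\lambda-i\Gamma_u\ne0$ for all $u\in V(G)$. The bond scattering matrix $\mathbf U(\lambda)=(U_{ef})_{e,f\in D(G)}$ is given by $$U_{ef}=\sigma_{ef}:=i\,\delta_{e^{-1},f}-\frac{2\sqrt{h_e}\sqrt{h_f}}{d_{t(e)}-\lambda-i\Gamma_{t(e)}}\,e^{i(\gamma_e+\gamma_f)}\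 \text{ if } t(e)=o(f),\qquad U_{ef}=0\ \text{ otherwise.}$$ Let $\Gamma$ be a finite group of order $p$ and $\alpha:D(G)\to\Gamma$ an ordinary voltage assignment, i.e. $\alpha(e^{-1})=\alpha(e)^{-1}$ for all $e$. The derived graph ($\Gamma$-covering) $G^\alpha$ has vertex set $V(G)\times\Gamma$ and arc set $D(G)\times\Gamma$; the arc $(e,g)$ runs from $(o(e),g)$ to $(t(e),g\alpha(e))$ and has inverse $(e^{-1},g\alpha(e))$. Lift the data by $\tilde d_{(u,g)}=d_u$, $\tilde h_{(e,g)}=h_e$, $\tilde\gamma_{(e,g)}=\gamma_e$, and let $\tilde{\mathbf U}(\lambda)$ be the bond scattering matrix of $G^\alpha$ for the lifted data. For $g\in\Gamma$ define matrices indexed by $D(G)$ and by $V(G)$, respectively: $$(\mathbf U_g)_{ef}=\begin{cases}\sigma_{ef}&\text{if } t(e)=o(f)\text{ and }\alpha(e)=g,\\0&\text{otherwise,}\end{cases}\qquad (\mathbf H_g)_{uv}=\sum_{f:\,o(f)=u,\ t(f)=v,\ \alpha(f)=g}h_fe^{2i\gamma_f}.$$ Let $\rho_1=1,\rho_2,\dots,\rho_k$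 be a complete list of pairwise inequivalent irreducible complex matrix representations of $\Gamma$, with degrees $f_1=1,f_2,\dots,f_k$. If $G^\alpha$ is connected, then $$\det(\mathbf I_{2mp}-\tilde{\mathbf U}(\lambda))=\det(\mathbf I_{2m}-\mathbf U(\lambda))\prod_{i=2}^{k}\det\Bigl(\mathbf I_{2mf_i}-\sum_{g\in\Gamma}\rho_i(g)\otimes\mathbf U_g\Bigr)^{f_i}$$ $$=\frac{2^{mp}(-1)^{np}\det(\lambda\mathbf I_n-\mathbf H)}{\prod_{u\in V(G)}(d_u-\lambda-i\Gamma_u)^p}\prod_{i=2}^{k}\det\Bigl(\lambda\mathbf I_{nf_i}-\sum_{g\in\Gamma}\rho_i(g)\otimes\mathbf H_g-\mathbf I_{f_i}\otimes\mathbf d\Bigr)^{f_i}.$$ -/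

import Mathlib

open Matrix
open scoped Kronecker

/-- A graph given by its arcs (oriented edges); multiple edges and loops are allowed.
`V` is the vertex set and `D` the set of arcs. Every unoriented edge, a loop included,
is a pair `{e, inv e}` of two distinct arcs. -/
structure ArcGraph (V D : Type*) where
  /-- origin of an arc -/
  o : D → V
  /-- terminus of an arc -/
  t : D → V
  /-- inverse arc -/
  inv : D → D
  inv_inv : ∀ e, inv (inv e) = e
  inv_ne : ∀ e, inv e ≠ e
  o_inv : ∀ e, o (inv e) = t e

namespace ArcGraph

variable {V D : Type*}

theorem t_inv (G : ArcGraph V D) (e : D) : G.t (G.inv e) = G.o e := by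
  rw [← G.o_inv, G.inv_inv]

/-- Any two vertices are joined by a path of arcs, and there is at least one vertex. -/
def Connected (G : ArcGraph V D) : Prop :=
  Nonempty V ∧ ∀ u v : V, Relation.ReflTransGen (fun x y => ∃ e, G.o e = x ∧ G.t e = y) u v

/-- The number of unoriented edges `{e, inv e}`. -/
noncomputable def numEdges (G : ArcGraph V D) : ℕ :=
  (Set.range fun e : D => s(e, G.inv e)).ncard

/-- An ordinary voltage assignment with values in the group `Γ`. -/
structure Voltage (G : ArcGraph V D) (Γ : Type*) [Group Γ] where
  /-- the voltage of an arc -/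
  val : D → Γ
  val_inv : ∀ e, val (G.inv e) = (val e)⁻¹

/-- The derived graph (`Γ`-covering) of a voltage graph: the arc `(e, g)` runs from
`(o e, g)` to `(t e, g * α e)`, and its inverse is `(e⁻¹, g * α e)`. -/
def derived (G : ArcGraph V D) {Γ : Type*} [Group Γ] (α : G.Voltage Γ) :
    ArcGraph (V × Γ) (D × Γ) where
  o a := (G.o a.1, a.2)
  t a := (G.t a.1, a.2 * α.val a.1)
  inv a := (G.inv a.1, a.2 * α.val a.1)
  inv_inv a := by simp [G.inv_inv, α.val_inv]
  inv_ne a h := G.inv_ne a.1 (congrArg Prod.fst h)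
  o_inv a := by simp [G.o_inv]

/-- The data of a Hermitian matrix on a graph: a real diagonal part `diag`, and on each arc
a modulus `h` and a half-phase `γ`, the arc `f` carrying the amplitude `h f * exp (2 i γ f)`. -/
structure HermitianData (G : ArcGraph V D) where
  diag : V → ℝ
  h : D → ℝ
  γ : D → ℝ
  h_nonneg : ∀ f, 0 ≤ h f
  h_inv : ∀ f, h (G.inv f) = h f
  γ_inv : ∀ f, γ (G.inv f) = -γ f
  γ_mem : ∀ f, γ f ∈ Set.Icc (-(Real.pi / 2)) (Real.pi / 2)

namespace HermitianData

variable {G : ArcGraph V D}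

/-- The data induced on the derived graph. -/
def lift (W : G.HermitianData) {Γ : Type*} [Group Γ] (α : G.Voltage Γ) :
    (G.derived α).HermitianData where
  diag x := W.diag x.1
  h a := W.h a.1
  γ a := W.γ a.1
  h_nonneg a := W.h_nonneg a.1
  h_inv a := W.h_inv a.1
  γ_inv a := W.γ_inv a.1
  γ_mem a := W.γ_mem a.1

/-- The amplitude `h f * exp (2 i γ f)` of an arc. -/
noncomputable def amp (W : G.HermitianData) (f : D) : ℂ :=
  (W.h f : ℂ) * Complex.exp (2 * Complex.I * (W.γ f : ℂ))

/-- The diagonal matrix of the diagonal part. -/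
def diagMatrix [DecidableEq V] (W : G.HermitianData) : Matrix V V ℂ :=
  Matrix.diagonal fun u => (W.diag u : ℂ)

/-- The Hermitian matrix `H`: the diagonal part plus, at the entry `(u, v)`, the amplitudes of
the arcs from `u` to `v` (parallel arcs add up; a loop adds to the diagonal entry). -/
noncomputable def matrixH [DecidableEq V] [Fintype D] (W : G.HermitianData) : Matrix V V ℂ :=
  W.diagMatrix + Matrix.of fun u v => ∑ f : D, if G.o f = u ∧ G.t f = v then W.amp f else 0

/-- The part `H_g` of `H` that comes from the arcs of voltage `g`. -/
noncomputable def matrixHg [DecidableEq V] [Fintype D] {Γ : Type*} [Group Γ] [DecidableEq Γ]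
    (W : G.HermitianData) (α : G.Voltage Γ) (g : Γ) : Matrix V V ℂ :=
  Matrix.of fun u v =>
    ∑ f : D, if G.o f = u ∧ G.t f = v ∧ α.val f = g then W.amp f else 0

/-- `Γ_u`, the sum of `h f` over the arcs `f` that emanate from `u`. -/
def totalWeight [DecidableEq V] [Fintype D] (W : G.HermitianData) (u : V) : ℝ :=
  ∑ f : D, if G.o f = u then W.h f else 0

/-- The denominator `H_uu - λ - i Γ_u`, with `H_uu` the diagonal part at `u`. -/
noncomputable def denom [DecidableEq V] [Fintype D] (W : G.HermitianData) (lam : ℂ) (u : V) : ℂ :=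
  (W.diag u : ℂ) - lam - Complex.I * (W.totalWeight u : ℂ)

/-- The vertex scattering coefficient `σ^{(t(e))}_{e f}(λ)`. -/
noncomputable def sigma [DecidableEq V] [Fintype D] [DecidableEq D]
    (W : G.HermitianData) (lam : ℂ) (e f : D) : ℂ :=
  Complex.I * (if G.inv e = f then 1 else 0)
    - 2 * (((Real.sqrt (W.h e) : ℂ) * (Real.sqrt (W.h f) : ℂ)) / W.denom lam (G.t e))
      * Complex.exp (Complex.I * ((W.γ f : ℂ) + (W.γ e : ℂ)))

/-- The bond scattering matrix `U(λ)`. -/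
noncomputable def matrixU [DecidableEq V] [Fintype D] [DecidableEq D]
    (W : G.HermitianData) (lam : ℂ) : Matrix D D ℂ :=
  Matrix.of fun e f => if G.t e = G.o f then W.sigma lam e f else 0

/-- The part `U_g` of the bond scattering matrix that comes from rows of voltage `g`. -/
noncomputable def matrixUg [DecidableEq V] [Fintype D] [DecidableEq D]
    {Γ : Type*} [Group Γ] [DecidableEq Γ]
    (W : G.HermitianData) (α : G.Voltage Γ) (lam : ℂ) (g : Γ) : Matrix D D ℂ :=
  Matrix.of fun e f => if G.t e = G.o f ∧ α.val e = g then W.sigma lam e f else 0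

theorem amp_inv (W : G.HermitianData) (f : D) : W.amp (G.inv f) = star (W.amp f) := by
  simp [amp, W.h_inv, W.γ_inv, ← Complex.exp_conj, map_ofNat (starRingEnd ℂ) 2]

/-- `matrixH` is Hermitian. -/
theorem matrixH_isHermitian [DecidableEq V] [Fintype D] (W : G.HermitianData) :
    W.matrixH.IsHermitian := by
  refine Matrix.IsHermitian.add ?_ ?_
  · exact Matrix.isHermitian_diagonal_of_self_adjoint _ (by ext u; simp)
  · ext u v
    simp only [Matrix.conjTranspose_apply, Matrix.of_apply, star_sum]
    let φ : D ≃ D := ⟨G.inv, G.inv, G.inv_inv, G.inv_inv⟩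
    refine Fintype.sum_equiv φ _ _ fun f => ?_
    change _ = if G.o (G.inv f) = u ∧ G.t (G.inv f) = v then W.amp (G.inv f) else 0
    rw [G.o_inv, G.t_inv, W.amp_inv]
    by_cases h : G.o f = v ∧ G.t f = u
    · rw [if_pos h, if_pos h.symm]
    · rw [if_neg h, if_neg (fun h' => h h'.symm), star_zero]

/-- At a vertex without loops the diagonal entry of `H` is the diagonal part. -/
theorem matrixH_diag [DecidableEq V] [Fintype D] (W : G.HermitianData) (u : V)
    (hu : ∀ f, G.o f = u → G.t f ≠ u) : W.matrixH u u = (W.diag u : ℂ) := by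
  simp only [matrixH, diagMatrix, Matrix.add_apply, Matrix.diagonal_apply_eq, Matrix.of_apply]
  rw [Finset.sum_eq_zero, add_zero]
  exact fun f _ => if_neg fun h => hu f h.1 h.2

end HermitianData

end ArcGraph

/-- The representation on `ℂ^d` given by a matrix representation of degree `d`. -/
noncomputable def matrixRep {Γ : Type*} [Group Γ] {d : ℕ}
    (ρ : Γ →* Matrix (Fin d) (Fin d) ℂ) : Representation ℂ Γ (Fin d → ℂ) :=
  (Matrix.toLinAlgEquiv' : Matrix (Fin d) (Fin d) ℂ ≃ₐ[ℂ] _).toAlgHom.toRingHom.toMonoidHom.comp ρ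

/-- `ρ` lists the irreducible complex matrix representations of `Γ`, each equivalence class
exactly once. -/
structure IsCompleteIrreps {Γ : Type*} [Group Γ] {k : ℕ} (deg : Fin k → ℕ)
    (ρ : ∀ i, Γ →* Matrix (Fin (deg i)) (Fin (deg i)) ℂ) : Prop where
  irreducible : ∀ i, (matrixRep (ρ i)).IsIrreducible
  inequivalent : ∀ i j, i ≠ j → IsEmpty ((matrixRep (ρ i)).Equiv (matrixRep (ρ j)))
  complete : ∀ (d : ℕ) (τ : Γ →* Matrix (Fin d) (Fin d) ℂ), (matrixRep τ).IsIrreducible →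
    ∃ i, Nonempty ((matrixRep τ).Equiv (matrixRep (ρ i)))

/-! Two independent facts carry the theorem. First, after reindexing, the scattering matrix of the
derived graph is `∑ g, R g ⊗ U_g` with `R` the right regular representation (`matrixU_lift`). The
matrix coefficients of the irreducibles form a basis of the functions on `Γ` that decomposes `R`
into `deg i` copies of each `ρ i`; hence `det (1 ⊗ X - ∑ R g ⊗ U g)` is the product of the
corresponding determinants for `ρ i`, each to the power `deg i` (`det_sub_sum_regular_kronecker`).
The trivial representation contributes the factor of the base graph. Second, for every matrix
representation `τ`, `∑ τ g ⊗ U_g = iJ - 2KCL`, where `J` is the twisted arc reversal, an involution,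
and `KCL` factors through the vertices. Since `(1 - iJ)(1 + iJ) = 2`, the factor `1 - iJ` splits
off, and `det (1 + XY) = det (1 + YX)` moves the rest from arcs to vertices, where the twisted `λ -
H` appears (`det_one_sub_sum_kronecker_matrixUg`). Applying this with `τ = R` and factoring the
vertex determinant by the first fact gives the second formula. -/

/-! ### Transport along equivalences of representations -/

namespace Representation

variable {k G V W : Type*} [Field k] [Group G] [AddCommGroup V] [Module k V] [AddCommGroup W]
  [Module k W] {ρ : Representation k G V} {σ : Representation k G W}

/-- Irreducibility is invariant under equivalence of representations. -/
theorem IsIrreducible.of_equiv (φ : ρ.Equiv σ) (h : ρ.IsIrreducible) : σ.IsIrreducible := by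
  rw [irreducible_iff_isSimpleModule_asModule] at h ⊢
  have hb : Function.Bijective
      (IntertwiningMap.equivLinearMapAsModule σ ρ φ.symm.toIntertwiningMap) :=
    φ.symm.toLinearEquiv.bijective
  exact IsSimpleModule.congr (LinearEquiv.ofBijective _ hb)

/-- If a linear combination of group elements acts as zero, it does so in every equivalent
representation. -/
theorem sum_smul_eq_zero_of_equiv [Fintype G] (φ : ρ.Equiv σ) (v : G → k)
    (h : ∑ g, v g • σ g = 0) : ∑ g, v g • ρ g = 0 := by
  ext x
  apply φ.toLinearEquiv.injective
  have h' := LinearMap.congr_fun h (φ x)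
  have key : ∀ g, φ (ρ g x) = σ g (φ x) := fun g =>
    Representation.IntertwiningMap.isIntertwining _ _ φ.toIntertwiningMap g x
  simp only [LinearMap.sum_apply, LinearMap.smul_apply, LinearMap.zero_apply, map_sum, map_smul,
    map_zero] at h' ⊢
  rw [← h']
  exact Finset.sum_congr rfl fun g _ => congrArg _ (key g)

end Representation

/-- A block diagonal matrix is block triangular for any linear order on the blocks; the order on
`Fin k` suffices below. -/
theorem Matrix.det_blockDiagonal'_of_linearOrder {R o : Type*} [CommRing R] [Fintype o]
    [LinearOrder o] {m : o → Type*} [∀ i, Fintype (m i)] [∀ i, DecidableEq (m i)]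
    (M : ∀ i, Matrix (m i) (m i) R) :
    (Matrix.blockDiagonal' M).det = ∏ i, (M i).det := by
  rw [(Matrix.blockTriangular_blockDiagonal' M).det_fintype]
  refine Finset.prod_congr rfl fun i _ => ?_
  let e : m i ≃ {x : Σ i, m i // x.1 = i} :=
    { toFun := fun a => ⟨⟨i, a⟩, rfl⟩
      invFun := fun x => x.2 ▸ x.1.2
      left_inv := fun _ => rfl
      right_inv := by rintro ⟨⟨j, a⟩, rfl⟩; rfl }
  rw [← Matrix.det_submatrix_equiv_self e]
  congr 1
  ext a b
  exact Matrix.blockDiagonal'_apply_eq M i a b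

/-! ### Irreducible representations and the regular representation -/

section MatrixRepresentations

variable {Γ : Type*} [Group Γ]

theorem matrixRep_apply {d : ℕ} (τ : Γ →* Matrix (Fin d) (Fin d) ℂ) (g : Γ) :
    matrixRep τ g = Matrix.toLinAlgEquiv' (τ g) := rfl

/-- Every finite-dimensional complex representation is equivalent to a matrix representation. -/
theorem exists_equiv_matrixRep {W : Type*} [AddCommGroup W] [Module ℂ W] [FiniteDimensional ℂ W]
    (σ : Representation ℂ Γ W) :
    ∃ (d : ℕ) (τ : Γ →* Matrix (Fin d) (Fin d) ℂ), Nonempty (σ.Equiv (matrixRep τ)) := by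
  let b := Module.finBasis ℂ W
  refine ⟨_, (LinearMap.toMatrixAlgEquiv b).toAlgHom.toRingHom.toMonoidHom.comp σ,
    ⟨Representation.Equiv.mk b.equivFun fun g => ?_⟩⟩
  ext x : 1
  exact (LinearMap.toMatrix_mulVec_repr b b (σ g) x).symm

variable [Fintype Γ]

/-- An element of the group algebra that acts as zero in all listed irreducible representations
acts as zero on every finite-dimensional simple module. -/
theorem IsCompleteIrreps.smul_eq_zero_of_isSimpleModule {k : ℕ} {deg : Fin k → ℕ}
    {ρ : ∀ i, Γ →* Matrix (Fin (deg i)) (Fin (deg i)) ℂ} (hρ : IsCompleteIrreps deg ρ)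
    (v : Γ → ℂ) (hv : ∀ i, ∑ g, v g • ρ i g = 0)
    (M : Type*) [AddCommGroup M] [Module ℂ M] [Module (MonoidAlgebra ℂ Γ) M]
    [IsScalarTower ℂ (MonoidAlgebra ℂ Γ) M] [FiniteDimensional ℂ M]
    [hM : IsSimpleModule (MonoidAlgebra ℂ Γ) M] (x : M) :
    (∑ g, MonoidAlgebra.single g (v g) : MonoidAlgebra ℂ Γ) • x = 0 := by
  let σ : Representation ℂ Γ M :=
    (MonoidAlgebra.lift ℂ (Module.End ℂ M) Γ).symm (Algebra.lsmul ℂ ℂ M)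
  have hσ : σ.asAlgebraHom = (Algebra.lsmul ℂ ℂ M : MonoidAlgebra ℂ Γ →ₐ[ℂ] Module.End ℂ M) := by
    rw [Representation.asAlgebraHom_def, Equiv.apply_symm_apply]
  have hirr : σ.IsIrreducible := by
    rw [Representation.irreducible_iff_isSimpleModule_asModule]
    let e : σ.asModule ≃ₗ[MonoidAlgebra ℂ Γ] M :=
      { σ.asModuleEquiv.toAddEquiv with
        map_smul' := fun r y => by
          have := σ.asModuleEquiv_map_smul r y
          rw [hσ] at this
          exact this }
    exact IsSimpleModule.congr e
  obtain ⟨d, τ, ⟨φ⟩⟩ := exists_equiv_matrixRep σ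
  obtain ⟨i, ⟨ψ⟩⟩ := hρ.complete d τ (hirr.of_equiv φ)
  have h0 := Representation.sum_smul_eq_zero_of_equiv (φ.trans ψ) v (by
    simp only [matrixRep_apply, ← map_smul, ← map_sum, hv i, map_zero])
  have h1 : σ.asAlgebraHom (∑ g, MonoidAlgebra.single g (v g)) = 0 := by
    rw [← h0]
    simp [map_sum, Representation.asAlgebraHom_single]
  rw [hσ] at h1
  exact LinearMap.congr_fun h1 x

/-- The irreducible representations separate the elements of the group algebra. -/
theorem IsCompleteIrreps.eq_zero_of_sum_smul_eq_zero {k : ℕ} {deg : Fin k → ℕ}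
    {ρ : ∀ i, Γ →* Matrix (Fin (deg i)) (Fin (deg i)) ℂ} (hρ : IsCompleteIrreps deg ρ)
    (v : Γ → ℂ) (hv : ∀ i, ∑ g, v g • ρ i g = 0) : v = 0 := by
  classical
  -- Maschke: the group algebra is the sum of its simple left ideals. Left multiplication by the
  -- given element kills each of them, hence kills `1`.
  have hx : (1 : MonoidAlgebra ℂ Γ) ∈ sSup {S : Submodule (MonoidAlgebra ℂ Γ) (MonoidAlgebra ℂ Γ) |
      IsSimpleModule (MonoidAlgebra ℂ Γ) S} := by
    rw [IsSemisimpleModule.sSup_simples_eq_top]; trivial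
  rw [sSup_eq_iSup'] at hx
  have h1 : (∑ g, MonoidAlgebra.single g (v g) : MonoidAlgebra ℂ Γ) * 1 = 0 := by
    refine Submodule.iSup_induction _
      (motive := fun x => (∑ g, MonoidAlgebra.single g (v g) : MonoidAlgebra ℂ Γ) * x = 0)
      hx ?_ (mul_zero _) fun x y h h' => by rw [mul_add, h, h', add_zero]
    rintro ⟨S, hS⟩ x hxS
    have : IsSimpleModule (MonoidAlgebra ℂ Γ) S := hS
    exact congrArg Subtype.val (hρ.smul_eq_zero_of_isSimpleModule v hv S ⟨x, hxS⟩)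
  funext g
  have := congrArg (fun z : MonoidAlgebra ℂ Γ => z.coeff g) h1
  simpa [MonoidAlgebra.coeff_sum, MonoidAlgebra.coeff_single, Finsupp.single_apply] using this

/-- The average of a matrix over the group intertwines the two representations. -/
theorem mul_sum_conj_eq_sum_conj_mul {c d : ℕ} (σ : Γ →* Matrix (Fin c) (Fin c) ℂ)
    (τ : Γ →* Matrix (Fin d) (Fin d) ℂ) (A : Matrix (Fin c) (Fin d) ℂ) (x : Γ) :
    σ x * ∑ g, σ g * A * τ g⁻¹ = (∑ g, σ g * A * τ g⁻¹) * τ x := by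
  rw [Matrix.mul_sum, Matrix.sum_mul]
  -- Substitution `g ↦ x * g` in the average.
  refine Fintype.sum_equiv (Equiv.mulLeft x) _ _ fun g => ?_
  simp only [Equiv.coe_mulLeft, _root_.mul_inv_rev, map_mul]
  simp only [Matrix.mul_assoc]
  rw [← map_mul τ x⁻¹ x, inv_mul_cancel, map_one, Matrix.mul_one]

/-- A matrix that intertwines two matrix representations. -/
noncomputable def intertwiningMapOfMatrix {c d : ℕ} {σ : Γ →* Matrix (Fin c) (Fin c) ℂ}
    {τ : Γ →* Matrix (Fin d) (Fin d) ℂ} (T : Matrix (Fin c) (Fin d) ℂ)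
    (hT : ∀ x, σ x * T = T * τ x) : (matrixRep τ).IntertwiningMap (matrixRep σ) where
  toLinearMap := Matrix.toLin' T
  isIntertwining' g := by
    rw [matrixRep_apply, matrixRep_apply]
    exact (Matrix.toLin'_mul T (τ g)).symm.trans ((congrArg _ (hT g)).symm.trans
      (Matrix.toLin'_mul (σ g) T))

variable {k : ℕ} {deg : Fin k → ℕ} {ρ : ∀ i, Γ →* Matrix (Fin (deg i)) (Fin (deg i)) ℂ}

/-- Schur orthogonality for two inequivalent irreducibles. -/
theorem IsCompleteIrreps.sum_conj_eq_zero (hρ : IsCompleteIrreps deg ρ) {i j : Fin k}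
    (hij : i ≠ j) (A : Matrix (Fin (deg i)) (Fin (deg j)) ℂ) :
    ∑ g, ρ i g * A * ρ j g⁻¹ = 0 := by
  have hj := hρ.irreducible j
  have hi := hρ.irreducible i
  have := hρ.inequivalent j i hij.symm
  have h := Subsingleton.elim
    (intertwiningMapOfMatrix _ (mul_sum_conj_eq_sum_conj_mul (ρ i) (ρ j) A)) 0
  have h' : Matrix.toLin' (∑ g, ρ i g * A * ρ j g⁻¹) = 0 :=
    congrArg Representation.IntertwiningMap.toLinearMap h
  exact Matrix.toLin'.injective (h'.trans (map_zero _).symm)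

/-- Schur orthogonality for a single irreducible. -/
theorem IsCompleteIrreps.smul_sum_conj (hρ : IsCompleteIrreps deg ρ) (i : Fin k)
    (A : Matrix (Fin (deg i)) (Fin (deg i)) ℂ) :
    (deg i : ℂ) • ∑ g, ρ i g * A * ρ i g⁻¹ = ((Fintype.card Γ : ℂ) * A.trace) • 1 := by
  have hi := hρ.irreducible i
  -- Schur's lemma over `ℂ` makes the average a scalar `c`; comparing traces then gives `card Γ *
  -- trace A = c * deg i`.
  obtain ⟨c, hc⟩ := (Representation.IsIrreducible.algebraMap_intertwiningMap_bijective_of_isAlgClosed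
    (ρ := matrixRep (ρ i))).2 (intertwiningMapOfMatrix _ (mul_sum_conj_eq_sum_conj_mul (ρ i) (ρ i) A))
  have h' : c • LinearMap.id = Matrix.toLin' (∑ g, ρ i g * A * ρ i g⁻¹) :=
    congrArg Representation.IntertwiningMap.toLinearMap hc
  have hs : ∑ g, ρ i g * A * ρ i g⁻¹ = c • 1 := by
    apply Matrix.toLin'.injective
    rw [← h', map_smul, Matrix.toLin'_one]
  have ht := congrArg Matrix.trace hs
  have hconj : ∀ g, (ρ i g * A * ρ i g⁻¹).trace = A.trace := fun g => by
    rw [Matrix.trace_mul_comm, ← Matrix.mul_assoc, ← map_mul, inv_mul_cancel, map_one,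
      Matrix.one_mul]
  simp only [Matrix.trace_sum, hconj, Finset.sum_const, Finset.card_univ, nsmul_eq_mul,
    Matrix.trace_smul, Matrix.trace_one, Fintype.card_fin, smul_eq_mul] at ht
  rw [hs, ht, smul_smul, mul_comm]

/-- The matrix whose columns are the matrix coefficients of the listed representations. -/
def coeffMatrix (ρ : ∀ i, Γ →* Matrix (Fin (deg i)) (Fin (deg i)) ℂ) :
    Matrix Γ (Σ i, Fin (deg i) × Fin (deg i)) ℂ :=
  Matrix.of fun g x => ρ x.1 g x.2.1 x.2.2

/-- The inverse of `coeffMatrix` for a complete list of irreducibles. -/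
noncomputable def coeffMatrixInv (ρ : ∀ i, Γ →* Matrix (Fin (deg i)) (Fin (deg i)) ℂ) :
    Matrix (Σ i, Fin (deg i) × Fin (deg i)) Γ ℂ :=
  Matrix.of fun x g => (deg x.1 : ℂ) / Fintype.card Γ * ρ x.1 g⁻¹ x.2.2 x.2.1

theorem mul_single_mul_apply {a b c d : Type*} [Fintype b] [Fintype c] [DecidableEq b]
    [DecidableEq c] (M : Matrix a b ℂ) (N : Matrix c d ℂ) (i : a) (j : b) (k : c) (l : d) :
    (M * Matrix.single j k (1 : ℂ) * N) i l = M i j * N k l := by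
  simp [Matrix.mul_apply, Matrix.single_apply, Finset.sum_ite_eq, ite_and]

/-- Each entry is an entry of an average `∑ g, ρ j g * A * ρ i g⁻¹` with `A` a matrix unit, so this
is Schur orthogonality. -/
theorem IsCompleteIrreps.coeffMatrixInv_mul (hρ : IsCompleteIrreps deg ρ) :
    coeffMatrixInv ρ * coeffMatrix ρ = 1 := by
  have hp : (Fintype.card Γ : ℂ) ≠ 0 := by simp
  ext ⟨i, a, b⟩ ⟨j, c, d⟩
  have key : (coeffMatrixInv ρ * coeffMatrix ρ) ⟨i, a, b⟩ ⟨j, c, d⟩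
      = (deg i : ℂ) / Fintype.card Γ
        * (∑ g, ρ j g * Matrix.single d b (1 : ℂ) * ρ i g⁻¹) c a := by
    rw [Matrix.mul_apply, Matrix.sum_apply, Finset.mul_sum]
    refine Finset.sum_congr rfl fun g _ => ?_
    rw [mul_single_mul_apply]
    simp only [coeffMatrixInv, coeffMatrix, Matrix.of_apply]
    ring
  rw [key]
  by_cases hij : i = j
  · subst hij
    have h := congrFun (congrFun (hρ.smul_sum_conj i (Matrix.single d b 1)) c) a
    rw [Matrix.smul_apply, smul_eq_mul] at h
    rw [div_mul_eq_mul_div, h, Matrix.smul_apply, smul_eq_mul, mul_assoc, mul_div_cancel_left₀ _ hp]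
    simp only [Matrix.one_apply, Matrix.trace, Matrix.diag, Matrix.single_apply]
    by_cases h1 : a = c <;> by_cases h2 : b = d <;>
      simp [h1, h2, eq_comm, ite_and]
  · rw [hρ.sum_conj_eq_zero (Ne.symm hij), Matrix.one_apply_ne (fun h => hij (congrArg Sigma.fst h))]
    simp

/-- The matrices are not known to be square, since `∑ deg i ^ 2 = card Γ` has not been proved.
Instead, each row of `P * Q - 1` is a group algebra element that acts as zero in every `ρ i`, so it
vanishes by separation. -/
theorem IsCompleteIrreps.coeffMatrix_mul (hρ : IsCompleteIrreps deg ρ) [DecidableEq Γ] :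
    coeffMatrix ρ * coeffMatrixInv ρ = 1 := by
  have h : (coeffMatrix ρ * coeffMatrixInv ρ - 1) * coeffMatrix ρ = 0 := by
    rw [Matrix.sub_mul, Matrix.mul_assoc, hρ.coeffMatrixInv_mul, Matrix.mul_one, Matrix.one_mul,
      sub_self]
  rw [← sub_eq_zero]
  ext x y
  refine congrFun (hρ.eq_zero_of_sum_smul_eq_zero
    ((coeffMatrix ρ * coeffMatrixInv ρ - 1 : Matrix Γ Γ ℂ) x) fun i => ?_) y
  ext a b
  have := congrFun (congrFun h x) ⟨i, a, b⟩
  rw [Matrix.mul_apply] at this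
  simpa [Matrix.sum_apply, coeffMatrix] using this

/-- The right regular representation by permutation matrices. -/
def regularMatrixRep (Γ : Type*) [Group Γ] [Fintype Γ] [DecidableEq Γ] : Γ →* Matrix Γ Γ ℂ where
  toFun g := Matrix.of fun x y => if x * g = y then 1 else 0
  map_one' := by ext x y; simp [Matrix.one_apply]
  map_mul' g h := by
    ext x y
    rw [Matrix.mul_apply, Finset.sum_eq_single (x * g)]
    · simp [mul_assoc]
    · intro z _ hz
      simp [Ne.symm hz]
    · simp

/-- Right translation of the coefficient `x ↦ ρ i x a b` mixes only the column index `b`; the idle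
row index `a` accounts for the multiplicity `deg i`. -/
theorem coeffMatrix_mul_blockDiagonal' (ρ : ∀ i, Γ →* Matrix (Fin (deg i)) (Fin (deg i)) ℂ)
    [DecidableEq Γ] (g : Γ) :
    coeffMatrix ρ * Matrix.blockDiagonal'
        (fun i => (1 : Matrix (Fin (deg i)) (Fin (deg i)) ℂ) ⊗ₖ ρ i g)
      = regularMatrixRep Γ g * coeffMatrix ρ := by
  ext x ⟨i, a, b⟩
  have hr : (regularMatrixRep Γ g * coeffMatrix ρ) x ⟨i, a, b⟩ = ρ i (x * g) a b := by
    rw [Matrix.mul_apply, Finset.sum_eq_single (x * g)]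
    · simp [regularMatrixRep, coeffMatrix]
    · intro z _ hz
      simp [regularMatrixRep, Ne.symm hz]
    · simp
  rw [hr, map_mul, Matrix.mul_apply, Matrix.mul_apply, Fintype.sum_sigma, Finset.sum_eq_single i]
  · rw [Fintype.sum_prod_type, Finset.sum_eq_single a]
    · simp [coeffMatrix]
    · intro c _ hc
      simp [hc]
    · simp
  · intro j _ hj
    refine Finset.sum_eq_zero fun y _ => ?_
    rw [Matrix.blockDiagonal'_apply_ne _ _ _ hj, mul_zero]
  · simp

/-- The regular representation contains every irreducible with multiplicity its degree, in
the form of a factorization of determinants. -/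
theorem IsCompleteIrreps.det_sum_regular_kronecker (hρ : IsCompleteIrreps deg ρ) [DecidableEq Γ]
    {D : Type*} [Fintype D] [DecidableEq D] (U : Γ → Matrix D D ℂ) :
    (∑ g, regularMatrixRep Γ g ⊗ₖ U g).det
      = ∏ i, (∑ g, ρ i g ⊗ₖ U g).det ^ deg i := by
  let B : Γ → Matrix (Σ i, Fin (deg i) × Fin (deg i)) (Σ i, Fin (deg i) × Fin (deg i)) ℂ :=
    fun g => Matrix.blockDiagonal' (fun i => (1 : Matrix (Fin (deg i)) (Fin (deg i)) ℂ) ⊗ₖ ρ i g)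
  let P := coeffMatrix ρ ⊗ₖ (1 : Matrix D D ℂ)
  let Q := coeffMatrixInv ρ ⊗ₖ (1 : Matrix D D ℂ)
  have hPQ : P * Q = 1 := by
    rw [← Matrix.mul_kronecker_mul, hρ.coeffMatrix_mul, Matrix.one_mul, Matrix.one_kronecker_one]
  have hQP : Q * P = 1 := by
    rw [← Matrix.mul_kronecker_mul, hρ.coeffMatrixInv_mul, Matrix.one_mul,
      Matrix.one_kronecker_one]
  have hconj : P * (∑ g, B g ⊗ₖ U g) * Q = ∑ g, regularMatrixRep Γ g ⊗ₖ U g := by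
    have : P * (∑ g, B g ⊗ₖ U g) = (∑ g, regularMatrixRep Γ g ⊗ₖ U g) * P := by
      rw [Matrix.mul_sum, Matrix.sum_mul]
      refine Finset.sum_congr rfl fun g _ => ?_
      rw [← Matrix.mul_kronecker_mul, ← Matrix.mul_kronecker_mul, Matrix.one_mul, Matrix.mul_one,
        coeffMatrix_mul_blockDiagonal']
    rw [this, Matrix.mul_assoc, hPQ, Matrix.mul_one]
  rw [← hconj, Matrix.det_conj_of_mul_eq_one hPQ hQP]
  -- Regrouping the indices moves the factor `D` inside the blocks.
  let ε : (Σ i, Fin (deg i) × (Fin (deg i) × D)) ≃ (Σ i, Fin (deg i) × Fin (deg i)) × D :=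
    { toFun := fun x => (⟨x.1, x.2.1, x.2.2.1⟩, x.2.2.2)
      invFun := fun y => ⟨y.1.1, y.1.2.1, y.1.2.2, y.2⟩
      left_inv := fun _ => rfl
      right_inv := fun _ => rfl }
  have hN : (∑ g, B g ⊗ₖ U g).submatrix ε ε = Matrix.blockDiagonal'
      (fun i => (1 : Matrix (Fin (deg i)) (Fin (deg i)) ℂ) ⊗ₖ (∑ g, ρ i g ⊗ₖ U g)) := by
    ext ⟨i, a, b, e⟩ ⟨j, c, d, f⟩
    rw [Matrix.submatrix_apply, Matrix.sum_apply]
    by_cases hij : i = j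
    · subst hij
      rw [Matrix.blockDiagonal'_apply_eq, Matrix.kroneckerMap_apply, Matrix.sum_apply]
      by_cases hac : a = c
      · subst hac
        simp [B, ε, Matrix.blockDiagonal'_apply]
      · simp [B, ε, Matrix.blockDiagonal'_apply, hac]
    · rw [Matrix.blockDiagonal'_apply_ne _ _ _ hij]
      simp [B, ε, Matrix.blockDiagonal'_apply, hij]
  rw [← Matrix.det_submatrix_equiv_self ε, hN, Matrix.det_blockDiagonal'_of_linearOrder]
  refine Finset.prod_congr rfl fun i _ => ?_
  rw [Matrix.det_kronecker, Matrix.det_one, one_pow, one_mul, Fintype.card_fin]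

/-- As `τ 1 = 1`, the term `1 ⊗ X` can be absorbed into the coefficient at `g = 1`, so the
factorization of linear sums covers the affine case. -/
theorem sum_kronecker_ite_sub {ι D : Type*} [DecidableEq ι] [Fintype ι] [DecidableEq Γ]
    (τ : Γ →* Matrix ι ι ℂ) (X : Matrix D D ℂ) (U : Γ → Matrix D D ℂ) :
    ∑ g, τ g ⊗ₖ ((if g = 1 then X else 0) - U g) = 1 ⊗ₖ X - ∑ g, τ g ⊗ₖ U g := by
  simp only [sub_eq_add_neg, Matrix.kronecker_add, Finset.sum_add_distrib]
  congr 1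
  · rw [Finset.sum_eq_single 1]
    · simp
    · intro g _ hg
      simp [hg]
    · simp
  · rw [← Finset.sum_neg_distrib]
    refine Finset.sum_congr rfl fun g _ => ?_
    ext x y
    simp

/-- The factorization of `det_sum_regular_kronecker` for the perturbations of `1 ⊗ X`. -/
theorem IsCompleteIrreps.det_sub_sum_regular_kronecker (hρ : IsCompleteIrreps deg ρ)
    [DecidableEq Γ] {D : Type*} [Fintype D] [DecidableEq D] (X : Matrix D D ℂ)
    (U : Γ → Matrix D D ℂ) :
    ((1 : Matrix Γ Γ ℂ) ⊗ₖ X - ∑ g, regularMatrixRep Γ g ⊗ₖ U g).det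
      = ∏ i, ((1 : Matrix (Fin (deg i)) (Fin (deg i)) ℂ) ⊗ₖ X
          - ∑ g, ρ i g ⊗ₖ U g).det ^ deg i := by
  rw [← sum_kronecker_ite_sub, hρ.det_sum_regular_kronecker]
  simp only [sum_kronecker_ite_sub]

end MatrixRepresentations

/-! ### Orientations of the edges -/

namespace ArcGraph

variable {V D : Type*}

/-- The underlying unoriented edge `{e, inv e}` of an arc. -/
def edge (G : ArcGraph V D) (e : D) : Sym2 D := s(e, G.inv e)

theorem edge_inv (G : ArcGraph V D) (e : D) : G.edge (G.inv e) = G.edge e := by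
  rw [edge, edge, G.inv_inv, Sym2.eq_swap]

theorem edge_eq_iff (G : ArcGraph V D) {e f : D} : G.edge e = G.edge f ↔ e = f ∨ e = G.inv f := by
  constructor
  · intro h
    rcases Sym2.eq_iff.1 h with h | h
    · exact Or.inl h.1
    · exact Or.inr h.1
  · rintro (rfl | rfl)
    · rfl
    · exact G.edge_inv f

/-- An orientation: a chosen arc of every unoriented edge. -/
noncomputable def orient (G : ArcGraph V D) (x : Set.range G.edge) : D := x.2.choose

theorem edge_orient (G : ArcGraph V D) (x : Set.range G.edge) : G.edge (G.orient x) = x :=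
  x.2.choose_spec

theorem orient_injective (G : ArcGraph V D) : Function.Injective G.orient := fun x y h =>
  Subtype.ext (by rw [← G.edge_orient x, ← G.edge_orient y, h])

theorem inv_orient_ne (G : ArcGraph V D) (x y : Set.range G.edge) :
    G.inv (G.orient x) ≠ G.orient y := fun h => by
  have hxy : x = y := Subtype.ext (by
    rw [← G.edge_orient x, ← G.edge_orient y, ← h, G.edge_inv])
  exact G.inv_ne _ (h.trans (congrArg _ hxy.symm))

/-- The arcs are the chosen arcs of the edges and their inverses. -/
noncomputable def orientEquiv (G : ArcGraph V D) : Set.range G.edge ⊕ Set.range G.edge ≃ D :=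
  Equiv.ofBijective (Sum.elim G.orient fun x => G.inv (G.orient x)) <| by
    constructor
    · rintro (x | x) (y | y) h
      · exact congrArg _ (G.orient_injective h)
      · exact absurd h.symm (G.inv_orient_ne y x)
      · exact absurd h (G.inv_orient_ne x y)
      · refine congrArg _ (G.orient_injective ?_)
        simpa [G.inv_inv] using congrArg G.inv h
    · intro e
      rcases G.edge_eq_iff.1 (G.edge_orient ⟨_, e, rfl⟩).symm with h | h
      · exact ⟨Sum.inl _, h.symm⟩
      · exact ⟨Sum.inr _, h.symm⟩

/-! ### Twisted arc reversal -/

section Twisted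

variable {Γ ι : Type*} [Group Γ] [Fintype ι] [DecidableEq ι] {G : ArcGraph V D}
  (α : G.Voltage Γ) (τ : Γ →* Matrix ι ι ℂ)

theorem Voltage.map_mul_map_inv (e : D) : τ (α.val e) * τ (α.val (G.inv e)) = 1 := by
  rw [← map_mul, α.val_inv, mul_inv_cancel, map_one]

/-- The arc reversal matrix twisted by a representation of the voltage group. -/
def Voltage.reversal [DecidableEq D] : Matrix (ι × D) (ι × D) ℂ :=
  Matrix.of fun x y => if G.inv x.2 = y.2 then τ (α.val x.2) x.1 y.1 else 0

theorem Voltage.reversal_mul_apply [DecidableEq D] [Fintype D] {κ : Type*}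
    (M : Matrix (ι × D) κ ℂ) (a : ι) (e : D) (y : κ) :
    (α.reversal τ * M) (a, e) y = ∑ c, τ (α.val e) a c * M (c, G.inv e) y := by
  rw [Matrix.mul_apply, Fintype.sum_prod_type]
  refine Finset.sum_congr rfl fun c _ => ?_
  simp [Voltage.reversal]

/-- Traversing an arc and then its inverse cancels the voltages. -/
theorem Voltage.reversal_mul_self [DecidableEq D] [Fintype D] :
    α.reversal τ * α.reversal τ = 1 := by
  ext ⟨a, e⟩ ⟨b, f⟩
  have h := congrFun (congrFun (α.map_mul_map_inv τ e) a) b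
  rw [Matrix.mul_apply] at h
  rw [Voltage.reversal_mul_apply]
  simp only [Voltage.reversal, Matrix.of_apply, G.inv_inv, mul_ite, mul_zero]
  by_cases hef : e = f
  · simp [hef, Matrix.one_apply] at h ⊢
    exact h
  · simp [hef]

/-- The determinant of `1 - i J` for the twisted arc reversal `J`. -/
theorem Voltage.det_one_sub_reversal [DecidableEq D] [Fintype D] :
    (1 - Complex.I • α.reversal τ).det = 2 ^ (G.numEdges * Fintype.card ι) := by
  classical
  have : Fintype (Set.range G.edge) := Fintype.ofFinite _
  let E := Set.range G.edge
  let ε : (ι × E) ⊕ (ι × E) ≃ ι × D :=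
    (Equiv.prodSumDistrib ι E E).symm.trans (Equiv.prodCongr (Equiv.refl ι) G.orientEquiv)
  let T : Matrix (ι × E) (ι × E) ℂ :=
    Matrix.of fun x y => if x.2 = y.2 then τ (α.val (G.orient x.2)) x.1 y.1 else 0
  let T' : Matrix (ι × E) (ι × E) ℂ :=
    Matrix.of fun x y => if x.2 = y.2 then τ (α.val (G.inv (G.orient x.2))) x.1 y.1 else 0
  have hl : ∀ a x, ε (Sum.inl (a, x)) = (a, G.orient x) := fun _ _ => rfl
  have hr : ∀ a x, ε (Sum.inr (a, x)) = (a, G.inv (G.orient x)) := fun _ _ => rfl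
  have hinj : ∀ x y : E, G.orient x = G.orient y ↔ x = y := fun x y => G.orient_injective.eq_iff
  have hinj' : ∀ x y : E, G.inv (G.orient x) = G.inv (G.orient y) ↔ x = y := fun x y =>
    ⟨fun h => G.orient_injective (by simpa [G.inv_inv] using congrArg G.inv h),
      fun h => by rw [h]⟩
  -- Reversal exchanges the chosen arcs with their inverses, so the diagonal blocks are `1`. The
  -- Schur complement is `1 - i² T' T = 2`.
  have hblock : (1 - Complex.I • α.reversal τ).submatrix ε ε
      = Matrix.fromBlocks 1 (-(Complex.I • T)) (-(Complex.I • T')) 1 := by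
    ext (⟨a, x⟩ | ⟨a, x⟩) (⟨b, y⟩ | ⟨b, y⟩) <;>
      simp [hl, hr, Voltage.reversal, T, T', Matrix.one_apply, G.inv_inv, hinj, hinj',
        G.inv_orient_ne, (G.inv_orient_ne _ _).symm]
  have hTT : T' * T = 1 := by
    ext ⟨a, x⟩ ⟨b, y⟩
    have h := congrFun (congrFun (α.map_mul_map_inv τ (G.inv (G.orient x))) a) b
    rw [Matrix.mul_apply, G.inv_inv] at h
    rw [Matrix.mul_apply, Fintype.sum_prod_type]
    by_cases hxy : x = y
    · subst hxy
      simpa [T, T', Matrix.one_apply] using h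
    · simp [T, T', hxy]
  have hcard : Fintype.card E = G.numEdges := by
    rw [numEdges, Set.ncard_eq_toFinset_card', Set.toFinset_card]
    exact Fintype.card_congr (Equiv.refl _)
  rw [← Matrix.det_submatrix_equiv_self ε, hblock, Matrix.det_fromBlocks_one₁₁]
  have h2 : (1 : Matrix (ι × E) (ι × E) ℂ) - -(Complex.I • T') * -(Complex.I • T)
      = (2 : ℂ) • 1 := by
    rw [neg_mul_neg, Matrix.smul_mul, Matrix.mul_smul, hTT, smul_smul, Complex.I_mul_I, two_smul]
    simp
  rw [h2, Matrix.det_smul, Matrix.det_one, mul_one, Fintype.card_prod, hcard, mul_comm]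

/-! ### From arcs to vertices -/

namespace HermitianData

variable (W : G.HermitianData)

/-- The square root `√h * exp (i γ)` of the amplitude of an arc. -/
noncomputable def halfAmp (f : D) : ℂ :=
  (Real.sqrt (W.h f) : ℂ) * Complex.exp (Complex.I * (W.γ f : ℂ))

theorem sqrt_mul_sqrt_ofReal (f : D) :
    (Real.sqrt (W.h f) : ℂ) * (Real.sqrt (W.h f) : ℂ) = W.h f := by
  rw [← Complex.ofReal_mul, Real.mul_self_sqrt (W.h_nonneg f)]

theorem halfAmp_mul_self (f : D) : W.halfAmp f * W.halfAmp f = W.amp f := by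
  rw [halfAmp, mul_mul_mul_comm, W.sqrt_mul_sqrt_ofReal, ← Complex.exp_add, amp]
  congr 2
  ring

theorem halfAmp_mul_halfAmp_inv (f : D) : W.halfAmp f * W.halfAmp (G.inv f) = W.h f := by
  rw [halfAmp, halfAmp, W.h_inv, W.γ_inv, mul_mul_mul_comm, W.sqrt_mul_sqrt_ofReal,
    ← Complex.exp_add]
  simp

variable [DecidableEq V] [Fintype D]

theorem sigma_eq [DecidableEq D] (lam : ℂ) (e f : D) :
    W.sigma lam e f = Complex.I * (if G.inv e = f then 1 else 0)
      - 2 * (W.halfAmp e * (W.denom lam (G.t e))⁻¹ * W.halfAmp f) := by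
  rw [sigma, halfAmp, halfAmp, mul_add, Complex.exp_add]
  ring

/-- Amplitudes from arcs to their termini, twisted by a representation. -/
noncomputable def arcToVertex : Matrix (ι × D) (ι × V) ℂ :=
  Matrix.of fun x y => if G.t x.2 = y.2 then τ (α.val x.2) x.1 y.1 * W.halfAmp x.2 else 0

variable (ι) in
/-- Amplitudes from vertices to the arcs emanating from them. -/
noncomputable def vertexToArc : Matrix (ι × V) (ι × D) ℂ :=
  (1 : Matrix ι ι ℂ) ⊗ₖ Matrix.of fun u f => if G.o f = u then W.halfAmp f else 0

variable (ι) in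
/-- The diagonal matrix of the inverse denominators. -/
noncomputable def invDenom (lam : ℂ) : Matrix (ι × V) (ι × V) ℂ :=
  Matrix.diagonal fun x => (W.denom lam x.2)⁻¹

theorem vertexToArc_mul_apply {κ : Type*} (M : Matrix (ι × D) κ ℂ) (a : ι) (u : V) (y : κ) :
    (W.vertexToArc ι * M) (a, u) y = ∑ f, if G.o f = u then W.halfAmp f * M (a, f) y else 0 := by
  rw [Matrix.mul_apply, Fintype.sum_prod_type, Finset.sum_eq_single a]
  · simp [vertexToArc]
  · intro b _ hb
    simp [vertexToArc, hb.symm]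
  · simp

theorem reversal_mul_arcToVertex_apply [DecidableEq D] (a b : ι) (e : D) (u : V) :
    (α.reversal τ * W.arcToVertex α τ) (a, e) (b, u)
      = if a = b ∧ G.o e = u then W.halfAmp (G.inv e) else 0 := by
  have h := congrFun (congrFun (α.map_mul_map_inv τ e) a) b
  rw [Matrix.mul_apply] at h
  rw [Voltage.reversal_mul_apply]
  by_cases hu : G.o e = u
  · simp [arcToVertex, G.t_inv, hu, ← mul_assoc, ← Finset.sum_mul, h, Matrix.one_apply]
  · simp [arcToVertex, G.t_inv, hu]

/-- The reflecting part of `sigma` is the twisted reversal; the remainder splits as arc, terminus,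
arc because its denominator depends only on the common vertex. -/
theorem sum_kronecker_matrixUg [Fintype V] [Fintype Γ]
    [DecidableEq Γ] [DecidableEq D] (lam : ℂ) :
    ∑ g, τ g ⊗ₖ W.matrixUg α lam g = Complex.I • α.reversal τ
      - (2 : ℂ) • (W.arcToVertex α τ * W.invDenom ι lam * W.vertexToArc ι) := by
  ext ⟨a, e⟩ ⟨b, f⟩
  have hprod : (W.arcToVertex α τ * W.invDenom ι lam * W.vertexToArc ι) (a, e) (b, f)
      = if G.t e = G.o f then
          τ (α.val e) a b * (W.halfAmp e * (W.denom lam (G.t e))⁻¹ * W.halfAmp f) else 0 := by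
    rw [Matrix.mul_apply, Fintype.sum_prod_type, Finset.sum_eq_single b]
    · simp only [invDenom, Matrix.mul_diagonal, arcToVertex, vertexToArc, Matrix.of_apply,
        Matrix.kroneckerMap_apply, Matrix.one_apply_eq, one_mul]
      rw [Finset.sum_eq_single (G.t e)]
      · by_cases h : G.t e = G.o f
        · simp [h, mul_assoc]
        · simp [h, Ne.symm h]
      · intro u _ hu
        simp [Ne.symm hu]
      · simp
    · intro c _ hc
      refine Finset.sum_eq_zero fun u _ => ?_
      simp [vertexToArc, hc]
    · simp
  have hsum : (∑ g, τ g ⊗ₖ W.matrixUg α lam g) (a, e) (b, f)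
      = if G.t e = G.o f then τ (α.val e) a b * W.sigma lam e f else 0 := by
    rw [Matrix.sum_apply, Finset.sum_eq_single (α.val e)]
    · simp [matrixUg]
    · intro g _ hg
      simp [matrixUg, Ne.symm hg]
    · simp
  rw [hsum, Matrix.sub_apply, Matrix.smul_apply, Matrix.smul_apply, hprod, sigma_eq]
  simp only [Voltage.reversal, Matrix.of_apply, smul_eq_mul]
  by_cases h : G.t e = G.o f
  · by_cases h' : G.inv e = f
    · simp only [h, h', if_true]; ring
    · simp only [h, h', if_true, if_false]; ring
  · have h' : G.inv e ≠ f := fun h' => h (by rw [← h', G.o_inv])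
    simp [h, h']

theorem vertexToArc_mul_arcToVertex [Fintype Γ] [DecidableEq Γ] :
    W.vertexToArc ι * W.arcToVertex α τ = ∑ g, τ g ⊗ₖ W.matrixHg α g := by
  ext ⟨a, u⟩ ⟨b, v⟩
  rw [vertexToArc_mul_apply, Matrix.sum_apply]
  simp only [Matrix.kroneckerMap_apply, matrixHg, Matrix.of_apply, Finset.mul_sum]
  rw [Finset.sum_comm]
  refine Finset.sum_congr rfl fun f _ => ?_
  rw [Finset.sum_eq_single (α.val f)]
  · rw [← W.halfAmp_mul_self]
    by_cases h : G.o f = u <;> by_cases h' : G.t f = v <;> simp [h, h', arcToVertex]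
    ring
  · intro g _ hg
    simp [Ne.symm hg]
  · simp

/-- Each term leaves `u` along an arc and returns along its inverse: voltages and phases cancel and
only `h f` remains. This is the source of `Γ_u`. -/
theorem vertexToArc_mul_reversal_mul_arcToVertex [DecidableEq D] :
    W.vertexToArc ι * (α.reversal τ * W.arcToVertex α τ)
      = Matrix.diagonal fun x : ι × V => (W.totalWeight x.2 : ℂ) := by
  ext ⟨a, u⟩ ⟨b, v⟩
  rw [vertexToArc_mul_apply]
  simp only [reversal_mul_arcToVertex_apply, Matrix.diagonal_apply, Prod.mk.injEq, totalWeight,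
    Complex.ofReal_sum]
  by_cases h : a = b ∧ u = v
  · rw [if_pos h]
    refine Finset.sum_congr rfl fun f _ => ?_
    obtain ⟨rfl, rfl⟩ := h
    by_cases hf : G.o f = u
    · simp [hf, W.halfAmp_mul_halfAmp_inv]
    · simp [hf]
  · rw [if_neg h]
    refine Finset.sum_eq_zero fun f _ => ?_
    by_cases hf : G.o f = u
    · subst hf
      simp [h]
    · simp [hf]

/-- The determinant of the twisted bond scattering matrix in terms of the twisted Hermitian
matrix. -/
theorem det_one_sub_sum_kronecker_matrixUg [Fintype V] [Fintype Γ]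
    [DecidableEq Γ] [DecidableEq D] (lam : ℂ)
    (hlam : ∀ u, W.denom lam u ≠ 0) :
    (1 - ∑ g, τ g ⊗ₖ W.matrixUg α lam g).det
      = 2 ^ (G.numEdges * Fintype.card ι) * (-1) ^ (Fintype.card V * Fintype.card ι)
        * (lam • (1 : Matrix (ι × V) (ι × V) ℂ) - ∑ g, τ g ⊗ₖ W.matrixHg α g
            - (1 : Matrix ι ι ℂ) ⊗ₖ W.diagMatrix).det
        / ∏ u, W.denom lam u ^ Fintype.card ι := by
  set J := α.reversal τ with hJ
  set K := W.arcToVertex α τ with hK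
  set C := W.invDenom ι lam with hC
  set L := W.vertexToArc ι with hL
  set A := ∑ g, τ g ⊗ₖ W.matrixHg α g with hA
  set N := lam • (1 : Matrix (ι × V) (ι × V) ℂ) - A - (1 : Matrix ι ι ℂ) ⊗ₖ W.diagMatrix with hN
  have hJJ : J * J = 1 := α.reversal_mul_self τ
  have hinv : (1 - Complex.I • J) * (1 + Complex.I • J) = (2 : ℂ) • 1 := by
    rw [Matrix.sub_mul, Matrix.one_mul, Matrix.mul_add, Matrix.mul_one,
      Matrix.smul_mul, Matrix.mul_smul, hJJ, smul_smul, Complex.I_mul_I, two_smul]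
    simp only [neg_smul, one_smul]
    abel
  -- The left side is `1 - iJ + 2KCL`, and `2` is replaced by `(1 - iJ)(1 + iJ)`.
  have hfact : 1 - ∑ g, τ g ⊗ₖ W.matrixUg α lam g
      = (1 - Complex.I • J) * (1 + ((1 + Complex.I • J) * K) * (C * L)) := by
    rw [W.sum_kronecker_matrixUg α τ lam, Matrix.mul_add, Matrix.mul_one, ← Matrix.mul_assoc,
      ← Matrix.mul_assoc (1 - Complex.I • J), hinv, Matrix.smul_mul, Matrix.one_mul,
      Matrix.smul_mul, ← Matrix.mul_assoc]
    abel
  -- With `1` written as `C` times the denominators `d - λ - iΓ`, the `iΓ` coming from `L * (iJ) *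
  -- K` cancels, leaving `A + d - λ = -N`.
  have hsmall : 1 + (C * L) * ((1 + Complex.I • J) * K) = C * -N := by
    have hLK : L * ((1 + Complex.I • J) * K)
        = A + Complex.I • Matrix.diagonal fun x : ι × V => (W.totalWeight x.2 : ℂ) := by
      rw [Matrix.add_mul, Matrix.one_mul, Matrix.mul_add, Matrix.smul_mul, Matrix.mul_smul,
        W.vertexToArc_mul_arcToVertex α τ, W.vertexToArc_mul_reversal_mul_arcToVertex α τ]
    have hone : C * Matrix.diagonal (fun x : ι × V => W.denom lam x.2) = 1 := by
      rw [hC, invDenom, Matrix.diagonal_mul_diagonal, ← Matrix.diagonal_one]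
      congr 1
      funext x
      exact inv_mul_cancel₀ (hlam x.2)
    rw [Matrix.mul_assoc, hLK, ← hone, ← Matrix.mul_add]
    congr 1
    ext ⟨a, u⟩ ⟨b, v⟩
    simp only [hN, Matrix.add_apply, Matrix.neg_apply, Matrix.sub_apply, Matrix.smul_apply,
      Matrix.diagonal_apply, Matrix.one_apply, Matrix.kroneckerMap_apply, diagMatrix, denom,
      Prod.mk.injEq, smul_eq_mul]
    by_cases h : a = b <;> by_cases h' : u = v <;> simp [h, h']
    ring
  have hdetC : C.det = (∏ u, W.denom lam u ^ Fintype.card ι)⁻¹ := by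
    rw [hC, invDenom, Matrix.det_diagonal, Fintype.prod_prod_type, Finset.prod_comm,
      ← Finset.prod_inv_distrib]
    simp
  rw [hfact, Matrix.det_mul, hJ, α.det_one_sub_reversal τ, Matrix.det_one_add_mul_comm, hsmall,
    Matrix.det_mul, Matrix.det_neg, hdetC, Fintype.card_prod, mul_comm (Fintype.card ι)]
  rw [div_eq_mul_inv]
  ring

end HermitianData

end Twisted

end ArcGraph

/-! ### The derived graph -/

namespace ArcGraph.HermitianData

variable {V D Γ : Type*} [DecidableEq V] [Fintype D] [Group Γ] [Fintype Γ]
  [DecidableEq Γ] {G : ArcGraph V D} (W : G.HermitianData) (α : G.Voltage Γ)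

theorem denom_lift (lam : ℂ) (x : V × Γ) : (W.lift α).denom lam x = W.denom lam x.1 := by
  have h : (W.lift α).totalWeight x = W.totalWeight x.1 := by
    rw [totalWeight, totalWeight, Fintype.sum_prod_type]
    refine Finset.sum_congr rfl fun f _ => ?_
    rw [Finset.sum_eq_single x.2]
    · simp [lift, derived, Prod.ext_iff]
    · intro g _ hg
      simp [derived, Prod.ext_iff, hg]
    · simp
  rw [denom, denom, h]
  rfl

theorem diagMatrix_add_sum_matrixHg : W.diagMatrix + ∑ g, W.matrixHg α g = W.matrixH := by
  rw [matrixH]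
  congr 1
  ext u v
  simp only [Matrix.sum_apply, matrixHg, Matrix.of_apply]
  rw [Finset.sum_comm]
  refine Finset.sum_congr rfl fun f _ => ?_
  simp [ite_and]

/-- This form, with `X = λ - d`, is the one to which the factorization along the regular
representation applies. -/
theorem twisted_eq_one_kronecker_sub {ι : Type*} [DecidableEq ι] (lam : ℂ)
    [Fintype ι] (τ : Γ →* Matrix ι ι ℂ) :
    lam • (1 : Matrix (ι × V) (ι × V) ℂ) - ∑ g, τ g ⊗ₖ W.matrixHg α g
        - (1 : Matrix ι ι ℂ) ⊗ₖ W.diagMatrix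
      = (1 : Matrix ι ι ℂ) ⊗ₖ (lam • 1 - W.diagMatrix) - ∑ g, τ g ⊗ₖ W.matrixHg α g := by
  rw [sub_eq_add_neg (lam • (1 : Matrix V V ℂ)), Matrix.kronecker_add, Matrix.kronecker_smul,
    Matrix.one_kronecker_one, ← neg_one_smul ℂ W.diagMatrix, Matrix.kronecker_smul, neg_one_smul]
  abel

variable [DecidableEq D]

/-- The bond scattering matrix of the derived graph, decomposed along the regular
representation. -/
theorem matrixU_lift (lam : ℂ) :
    (W.lift α).matrixU lam = (∑ g, regularMatrixRep Γ g ⊗ₖ W.matrixUg α lam g).submatrix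
      (Equiv.prodComm D Γ) (Equiv.prodComm D Γ) := by
  ext ⟨e, x⟩ ⟨f, y⟩
  -- Row `e` occurs only in the part of voltage `α.val e`, and right translation by it is the change
  -- of sheet along the lifted arc.
  rw [Matrix.submatrix_apply, Matrix.sum_apply, Finset.sum_eq_single (α.val e)]
  · have hd : (W.lift α).denom lam ((G.derived α).t (e, x)) = W.denom lam (G.t e) :=
      W.denom_lift α lam _
    simp only [matrixU, Matrix.of_apply, sigma, hd]
    simp only [regularMatrixRep, Matrix.of_apply,
      Matrix.kroneckerMap_apply, MonoidHom.coe_mk, OneHom.coe_mk, Equiv.prodComm_apply,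
      Prod.fst_swap, Prod.snd_swap, matrixUg, sigma, derived, Prod.mk.injEq, and_true, lift]
    by_cases h : x * α.val e = y
    · simp [h]
    · simp [h]
  · intro g _ hg
    simp [matrixUg, Ne.symm hg]
  · simp

theorem det_one_sub_matrixU_lift (lam : ℂ) :
    (1 - (W.lift α).matrixU lam).det
      = (1 - ∑ g, regularMatrixRep Γ g ⊗ₖ W.matrixUg α lam g).det := by
  rw [matrixU_lift, ← Matrix.det_submatrix_equiv_self (Equiv.prodComm D Γ), Matrix.submatrix_sub,
    Pi.sub_apply, Pi.sub_apply, Matrix.submatrix_one_equiv]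

theorem sum_matrixUg (lam : ℂ) : ∑ g, W.matrixUg α lam g = W.matrixU lam := by
  ext e f
  simp [Matrix.sum_apply, matrixUg, matrixU, ite_and]

end ArcGraph.HermitianData

/-- A trivial representation of degree one does not twist the determinant. -/
theorem Matrix.det_pow_one_kronecker_sub_of_trivial {d : ℕ} (hd : d = 1) {D Γ : Type*} [Fintype D]
    [DecidableEq D] [Fintype Γ] (τ : Γ → Matrix (Fin d) (Fin d) ℂ) (hτ : ∀ g, τ g = 1)
    (X : Matrix D D ℂ) (U : Γ → Matrix D D ℂ) :
    ((1 : Matrix (Fin d) (Fin d) ℂ) ⊗ₖ X - ∑ g, τ g ⊗ₖ U g).det ^ d = (X - ∑ g, U g).det := by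
  have h : (1 : Matrix (Fin d) (Fin d) ℂ) ⊗ₖ X - ∑ g, τ g ⊗ₖ U g
      = (1 : Matrix (Fin d) (Fin d) ℂ) ⊗ₖ (X - ∑ g, U g) := by
    ext x y
    simp [hτ, Matrix.sum_apply, mul_sub, Finset.mul_sum]
  rw [h, Matrix.det_kronecker, Matrix.det_one, one_pow, one_mul, Fintype.card_fin, hd, pow_one,
    pow_one]

theorem theorem6 {V D Γ : Type*} [Fintype V] [DecidableEq V] [Fintype D] [DecidableEq D]
    [Group Γ] [Fintype Γ] [DecidableEq Γ]
    (G : ArcGraph V D) (hG : G.Connected)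
    (α : G.Voltage Γ) (hGα : (G.derived α).Connected)
    (W : G.HermitianData)
    (n m p : ℕ) (hn : Fintype.card V = n) (hm : G.numEdges = m) (hp : Fintype.card Γ = p)
    (k : ℕ) (deg : Fin (k + 1) → ℕ)
    (ρ : ∀ i, Γ →* Matrix (Fin (deg i)) (Fin (deg i)) ℂ)
    (hρ : IsCompleteIrreps deg ρ)
    (hdeg : deg 0 = 1) (hρ0 : ∀ g, ρ 0 g = 1)
    (lam : ℂ) (hlam : ∀ u, W.denom lam u ≠ 0) :
    (1 - (W.lift α).matrixU lam).det
        = (1 - W.matrixU lam).det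
          * ∏ i : Fin k,
              (1 - ∑ g : Γ, ρ i.succ g ⊗ₖ W.matrixUg α lam g).det ^ deg i.succ
    ∧ (1 - (W.lift α).matrixU lam).det
        = (2 ^ (m * p) * (-1) ^ (n * p) * (lam • (1 : Matrix V V ℂ) - W.matrixH).det)
            / (∏ u : V, W.denom lam u ^ p)
          * ∏ i : Fin k,
              (lam • (1 : Matrix (Fin (deg i.succ) × V) (Fin (deg i.succ) × V) ℂ)
                - ∑ g : Γ, ρ i.succ g ⊗ₖ W.matrixHg α g
                - (1 : Matrix (Fin (deg i.succ)) (Fin (deg i.succ)) ℂ) ⊗ₖ W.diagMatrix).det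
                ^ deg i.succ := by

  subst hn hm hp
  constructor
  · rw [W.det_one_sub_matrixU_lift α, ← Matrix.one_kronecker_one,
      hρ.det_sub_sum_regular_kronecker, Fin.prod_univ_succ,
      Matrix.det_pow_one_kronecker_sub_of_trivial hdeg _ hρ0, W.sum_matrixUg α]
    simp only [Matrix.one_kronecker_one]
  -- The passage to vertices is made once, for the regular representation, where `card ι = p` gives
  -- all exponents directly; only then is the vertex determinant factored.
  · rw [W.det_one_sub_matrixU_lift α,
      W.det_one_sub_sum_kronecker_matrixUg α (regularMatrixRep Γ) lam hlam, W.twisted_eq_one_kronecker_sub α,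
      hρ.det_sub_sum_regular_kronecker, Fin.prod_univ_succ,
      Matrix.det_pow_one_kronecker_sub_of_trivial hdeg _ hρ0, sub_sub,
      W.diagMatrix_add_sum_matrixHg α]
    simp only [W.twisted_eq_one_kronecker_sub α]
    ring
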